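/- Let $n\ge 1$ and $p\in[1,\infty)$. Let $\mathrm{Conv}_{(c,n)}$ be the set of all functions $u:\mathbb{R}^n\to\mathbb{R}\cup\{+\infty\}$ that are proper ($u\not\equiv+\infty$), lower semicontinuous, coercive ($\lim_{|x|\to\infty}u(x)=+\infty$) and convex, and whose domain $\operatorname{dom}u=\{x:u(x)<+\infty\}$ has dimension $n$. Let $\zeta:\mathbb{R}\to(0,\infty)$ be continuous and strictly decreasing such that $\zeta^p$ has finite moment of order $n-1$, that is, $\int_0^\infty \zeta(t)^p\,t^{n-1}\,dt<+\infty$, and put $\zeta(+\infty):=\lim_{t\to\infty}\zeta(t)=0$. Then $$\delta_{\zeta,p}(u,v)=\|\zeta\circ u-\zeta\circ v\|_p=\Big(\int_{\mathbb{R}^n}|\zeta(u(x))-\zeta(v(x))|^p\,dx\Big)^{1/p}$$ is finite for all $u,v\in\mathrm{Conv}_{(c,n)}$ and defines a metric on $\mathrm{Conv}_{(c,n)}$. Furthermore, for every sequence $u_k\in\mathrm{Conv}_{(c,n)}$ and every $u\in\mathrm{Conv}_{(c,n)}$, as $k\to\infty$, $$\delta_{\zeta,p}(u_k,u)\to 0\quad\Longleftrightarrow\quad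 u_k \text{ epi-converges to } u,$$ where $u_k$ epi-converges to $u$ if for every $x\in\mathbb{R}^n$ one has $\liminf_{k\to\infty}u_k(x_k)\ge u(x)$ for every sequence $x_k\to x$, and $\limsup_{k\to\infty}u_k(x_k)\le u(x)$ for some sequence $x_k\to x$. -/

import Mathlib

open Filter Topology MeasureTheory

noncomputable section

namespace EpiMetric

/-- `n`-dimensional Euclidean space. -/
abbrev Rn (n : ℕ) : Type := EuclideanSpace ℝ (Fin n)

/-- The domain `{x | u x < +∞}` of an extended-real-valued function. -/
def effDom {n : ℕ} (u : Rn n → EReal) : Set (Rn n) := {x | u x < ⊤}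

/-- Proper, lower semicontinuous, coercive, convex functions `u : ℝⁿ → ℝ ∪ {+∞}` whose domain has
dimension `n`. The values lie in `EReal`, with `-∞` excluded by `ne_bot`. -/
structure IsCVcn {n : ℕ} (u : Rn n → EReal) : Prop where
  ne_bot : ∀ x, u x ≠ ⊥
  proper : ∃ x, u x ≠ ⊤
  lsc : LowerSemicontinuous u
  coercive : Tendsto u (Bornology.cobounded (Rn n)) (𝓝 ⊤)
  convex : ∀ (x y : Rn n) (a b : ℝ), 0 < a → 0 < b → a + b = 1 →
    u (a • x + b • y) ≤ (a : EReal) * u x + (b : EReal) * u y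
  full_dim : Module.finrank ℝ (vectorSpan ℝ (effDom u)) = n

/-- The space of functions described by `IsCVcn`. -/
def CVcn (n : ℕ) : Type := {u : Rn n → EReal // IsCVcn u}

instance (n : ℕ) : CoeFun (CVcn n) (fun _ => Rn n → EReal) := ⟨fun u => u.1⟩

/-- `ζ : ℝ → (0, ∞)` is continuous and strictly decreasing, and `ζ ^ p` has finite moment of order
`n - 1`. Only used for `1 ≤ n`. -/
structure IsMom (p : ℝ) (n : ℕ) (ζ : ℝ → ℝ) : Prop where
  pos : ∀ t, 0 < ζ t
  cont : Continuous ζ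
  anti : StrictAnti ζ
  moment : IntegrableOn (fun t : ℝ => ζ t ^ p * t ^ (n - 1)) (Set.Ioi 0) volume

/-- `ζ` evaluated at a value in `ℝ ∪ {+∞}`, with the convention `ζ(+∞) = lim_{t → ∞} ζ(t) = 0`. -/
def zetaVal (ζ : ℝ → ℝ) (s : EReal) : ℝ := if s = ⊤ then 0 else ζ s.toReal

/-- `δ_{ζ,p}(u, v) = (∫ |ζ(u(x)) - ζ(v(x))| ^ p dx) ^ (1/p)`. -/
def delta {n : ℕ} (ζ : ℝ → ℝ) (p : ℝ) (u v : CVcn n) : ℝ :=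
  (∫ x, |zetaVal ζ (u x) - zetaVal ζ (v x)| ^ p) ^ (1 / p)

/-- Epi-convergence of a sequence of functions. -/
def EpiConverges {n : ℕ} (u : ℕ → Rn n → EReal) (v : Rn n → EReal) : Prop :=
  ∀ x : Rn n,
    (∀ y : ℕ → Rn n, Tendsto y atTop (𝓝 x) → v x ≤ liminf (fun k => u k (y k)) atTop) ∧
    (∃ y : ℕ → Rn n, Tendsto y atTop (𝓝 x) ∧ limsup (fun k => u k (y k)) atTop ≤ v x)

end EpiMetric

end

open Filter Topology MeasureTheory

namespace EpiMetric

/-! ### Composition with `ζ` -/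

section Zeta

variable {ζ : ℝ → ℝ} {p : ℝ} {n : ℕ}

/-! The map `u ↦ ζ ∘ u` embeds the space into `L ^ p`. A coercive convex function lies above a cone
`a ‖x‖ - b`, and polar coordinates reduce the integral over a cone to the moment of `ζ ^ p`.
Injectivity rests on `IsCVcn.volume_pos`.

Epi-convergence gives metric convergence by dominated convergence: `exists_uniform_cone` supplies
the bound and `ae_tendsto_of_epi` the pointwise limit.

Conversely, Markov's inequality gives convergence in measure, and convexity excludes exceptional
values on small sets: a low value of `u k` at one point forces low values on a contracted copy of
half a ball, whose volume is bounded below. -/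

lemma zetaVal_top : zetaVal ζ ⊤ = 0 := by simp [zetaVal]

lemma zetaVal_coe (r : ℝ) : zetaVal ζ (r : EReal) = ζ r := by simp [zetaVal]

lemma IsMom.zetaVal_nonneg (hζ : IsMom p n ζ) (s : EReal) : 0 ≤ zetaVal ζ s := by
  unfold zetaVal
  split_ifs
  · exact le_rfl
  · exact (hζ.pos _).le

/-- `⊥` is excluded because `EReal.toReal ⊥ = 0`, which makes `zetaVal ζ ⊥ = ζ 0`. -/
lemma IsMom.zetaVal_lt (hζ : IsMom p n ζ) {s t : EReal} (hs : s ≠ ⊥) (h : s < t) :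
    zetaVal ζ t < zetaVal ζ s := by
  lift s to ℝ using ⟨h.ne_top, hs⟩
  rw [zetaVal_coe]
  by_cases ht : t = ⊤
  · rw [ht, zetaVal_top]
    exact hζ.pos s
  · lift t to ℝ using ⟨ht, (bot_le.trans_lt h).ne'⟩
    rw [zetaVal_coe]
    exact hζ.anti (EReal.coe_lt_coe_iff.1 h)

lemma IsMom.zetaVal_le (hζ : IsMom p n ζ) {s t : EReal} (hs : s ≠ ⊥) (h : s ≤ t) :
    zetaVal ζ t ≤ zetaVal ζ s := by
  rcases h.eq_or_lt with rfl | h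
  · exact le_rfl
  · exact (hζ.zetaVal_lt hs h).le

lemma IsMom.zetaVal_injOn (hζ : IsMom p n ζ) {s t : EReal} (hs : s ≠ ⊥) (ht : t ≠ ⊥)
    (h : zetaVal ζ s = zetaVal ζ t) : s = t := by
  rcases lt_trichotomy s t with hst | hst | hst
  · exact absurd h (hζ.zetaVal_lt hs hst).ne'
  · exact hst
  · exact absurd h (hζ.zetaVal_lt ht hst).ne

lemma IsMom.measurable_zetaVal (hζ : IsMom p n ζ) : Measurable (zetaVal ζ) := by
  unfold zetaVal
  exact Measurable.ite (measurableSet_singleton _) measurable_const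
    (hζ.cont.measurable.comp measurable_ereal_toReal)

/-- A function with a finite moment takes arbitrarily small values. -/
lemma IsMom.exists_lt (hζ : IsMom p n ζ) (hp : 1 ≤ p) {c : ℝ} (hc : 0 < c) : ∃ t, ζ t < c := by
  by_contra! h
  have h1 : IntegrableOn (fun t : ℝ => ζ t ^ p * t ^ (n - 1)) (Set.Ioi 1) volume :=
    hζ.moment.mono_set (Set.Ioi_subset_Ioi zero_le_one)
  have h2 : IntegrableOn (fun _ : ℝ => c ^ p) (Set.Ioi 1) volume := by
    refine h1.mono' aestronglyMeasurable_const ?_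
    refine (ae_restrict_iff' measurableSet_Ioi).2 (Eventually.of_forall fun t ht => ?_)
    have ht' : (1 : ℝ) ≤ t ^ (n - 1) := one_le_pow₀ (le_of_lt ht)
    rw [Real.norm_of_nonneg (Real.rpow_nonneg hc.le p)]
    calc c ^ p ≤ ζ t ^ p := Real.rpow_le_rpow hc.le (h t) (by linarith)
      _ ≤ ζ t ^ p * t ^ (n - 1) := le_mul_of_one_le_right (Real.rpow_nonneg (hζ.pos t).le p) ht'
  rw [integrableOn_const_iff] at h2
  rcases h2 with h2 | h2
  · exact (Real.rpow_pos_of_pos hc p).ne' (enorm_eq_zero.1 h2)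
  · simp at h2

lemma IsMom.continuousAt_zetaVal (hζ : IsMom p n ζ) (hp : 1 ≤ p) {s : EReal} (hs : s ≠ ⊥) :
    ContinuousAt (zetaVal ζ) s := by
  by_cases ht : s = ⊤
  · subst ht
    rw [ContinuousAt, zetaVal_top, tendsto_order]
    refine ⟨fun a ha => Eventually.of_forall fun t => ha.trans_le (hζ.zetaVal_nonneg t),
      fun a ha => ?_⟩
    obtain ⟨t, ht⟩ := hζ.exists_lt hp ha
    filter_upwards [lt_mem_nhds (EReal.coe_lt_top t)] with x hx
    have := hζ.zetaVal_le (EReal.coe_ne_bot t) (le_of_lt hx)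
    rw [zetaVal_coe] at this
    exact this.trans_lt ht
  · have h1 : ContinuousAt (fun x : EReal => ζ x.toReal) s :=
      hζ.cont.continuousAt.tendsto.comp (EReal.tendsto_toReal ht hs)
    refine h1.congr ?_
    filter_upwards [isOpen_ne.mem_nhds ht] with x hx
    have hx : x ≠ ⊤ := hx
    simp [zetaVal, hx]

/-- `x ↦ ζ (a ‖x‖ - b)` is in `L ^ p`. -/
lemma IsMom.integrable_cone (hζ : IsMom p n ζ) (hn : 1 ≤ n) (hp : 1 ≤ p) {a : ℝ} (ha : 0 < a)
    (b : ℝ) : Integrable (fun x : Rn n => ζ (a * ‖x‖ - b) ^ p) := by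
  have : Nontrivial (Rn n) := by
    have : Nonempty (Fin n) := ⟨⟨0, hn⟩⟩
    infer_instance
  have h1 : Integrable (fun x : Rn n => ζ ‖x‖ ^ p) := by
    rw [integrable_fun_norm_addHaar (volume : Measure (Rn n)) (f := fun t => ζ t ^ p)]
    have := hζ.moment
    simp only [finrank_euclideanSpace_fin, smul_eq_mul]
    simpa only [mul_comm] using this
  -- Outside the ball of radius `2 * |b| / a`, `a * ‖x‖ - b ≥ (a / 2) * ‖x‖`; inside it, `ζ (-b) ^
  -- p` is a bound.
  have h2 := h1.comp_smul (R := a / 2) (by positivity)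
  have h3 : Integrable ((Metric.closedBall (0 : Rn n) (2 * |b| / a)).indicator
      (fun _ => ζ (-b) ^ p)) :=
    (integrable_indicator_iff Metric.isClosed_closedBall.measurableSet).2
      (integrableOn_const Metric.isBounded_closedBall.measure_lt_top.ne)
  refine (h2.add h3).mono' ?_ (Eventually.of_forall fun x => ?_)
  · have hm : Measurable fun x : Rn n => ζ (a * ‖x‖ - b) :=
      hζ.cont.measurable.comp ((measurable_norm.const_mul a).sub_const b)
    exact (hm.pow_const p).aestronglyMeasurable
  · have hp0 : 0 ≤ p := by linarith
    rw [Real.norm_of_nonneg (Real.rpow_nonneg (hζ.pos _).le p), Pi.add_apply]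
    by_cases hx : x ∈ Metric.closedBall (0 : Rn n) (2 * |b| / a)
    · rw [Set.indicator_of_mem hx]
      have : ζ (a * ‖x‖ - b) ^ p ≤ ζ (-b) ^ p := by
        refine Real.rpow_le_rpow (hζ.pos _).le (hζ.anti.antitone ?_) hp0
        have : 0 ≤ a * ‖x‖ := by positivity
        linarith
      have := Real.rpow_nonneg (hζ.pos ‖(a / 2) • x‖).le p
      linarith
    · rw [Set.indicator_of_notMem hx, add_zero]
      refine Real.rpow_le_rpow (hζ.pos _).le (hζ.anti.antitone ?_) hp0
      rw [norm_smul, Real.norm_of_nonneg (by positivity : 0 ≤ a / 2)]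
      rw [mem_closedBall_zero_iff, not_le, div_lt_iff₀ ha] at hx
      have := le_abs_self b
      nlinarith

end Zeta

/-! ### Convexity and sublevel sets -/

section Convex

variable {n : ℕ} {u : Rn n → EReal}

lemma IsCVcn.le_of_le (hu : IsCVcn u) {x y : Rn n} {α β a b : ℝ} (hx : u x ≤ α) (hy : u y ≤ β)
    (ha : 0 < a) (hb : 0 < b) (hab : a + b = 1) :
    u (a • x + b • y) ≤ ((a * α + b * β : ℝ) : EReal) := by
  refine (hu.convex x y a b ha hb hab).trans ?_
  push_cast
  gcongr

lemma IsCVcn.convex_sublevel (hu : IsCVcn u) (s : ℝ) : Convex ℝ {x | u x ≤ s} := by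
  refine convex_iff_forall_pos.2 fun x hx y hy a b ha hb hab => ?_
  have := hu.le_of_le hx hy ha hb hab
  rwa [← add_mul, hab, one_mul] at this

lemma IsCVcn.isClosed_sublevel (hu : IsCVcn u) (s : ℝ) : IsClosed {x | u x ≤ s} :=
  hu.lsc.isClosed_preimage _

lemma IsCVcn.effDom_eq_iUnion (hu : IsCVcn u) : effDom u = ⋃ k : ℕ, {x | u x ≤ (k : ℝ)} := by
  ext x
  simp only [effDom, Set.mem_ofPred_eq, Set.mem_iUnion]
  constructor
  · intro h
    obtain ⟨k, hk⟩ := exists_nat_ge (u x).toReal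
    refine ⟨k, ?_⟩
    rw [← EReal.coe_toReal h.ne (hu.ne_bot x)]
    exact EReal.coe_le_coe_iff.2 hk
  · rintro ⟨k, hk⟩
    exact hk.trans_lt (EReal.coe_lt_top _)

lemma IsCVcn.convex_effDom (hu : IsCVcn u) : Convex ℝ (effDom u) := by
  rw [hu.effDom_eq_iUnion]
  refine Directed.convex_iUnion ?_ fun k => hu.convex_sublevel k
  refine Monotone.directed_le fun i j hij x (hx : u x ≤ _) => ?_
  refine hx.trans ?_
  exact EReal.coe_le_coe_iff.2 (Nat.cast_le.2 hij)

/-- A function of full-dimensional domain is bounded above on some ball. -/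
lemma IsCVcn.exists_ball (hu : IsCVcn u) :
    ∃ (c : Rn n) (r M : ℝ), 0 < r ∧ ∀ x ∈ Metric.ball c r, u x ≤ M := by
  have h1 : (interior (effDom u)).Nonempty := by
    rw [hu.convex_effDom.interior_nonempty_iff_affineSpan_eq_top,
      ← AffineSubspace.direction_eq_top_iff_of_nonempty, direction_affineSpan]
    · refine Submodule.eq_top_of_finrank_eq ?_
      rw [hu.full_dim, finrank_euclideanSpace_fin]
    · rw [affineSpan_nonempty]
      obtain ⟨x, hx⟩ := hu.proper
      exact ⟨x, lt_top_iff_ne_top.2 hx⟩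
  have h2 : volume (effDom u) ≠ 0 := (Measure.measure_pos_of_nonempty_interior _ h1).ne'
  -- A countable union of null sets is null, so some sublevel set has positive volume; its convexity
  -- makes its frontier null, so it has interior.
  have h3 : ∃ k : ℕ, volume {x | u x ≤ ((k : ℝ) : EReal)} ≠ 0 := by
    by_contra! h
    exact h2 (by rw [hu.effDom_eq_iUnion]; exact measure_iUnion_null h)
  obtain ⟨k, hk⟩ := h3
  have h4 : (interior {x | u x ≤ ((k : ℝ) : EReal)}).Nonempty := by
    by_contra h
    rw [Set.not_nonempty_iff_eq_empty] at h
    refine hk ?_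
    have := (hu.convex_sublevel k).addHaar_frontier volume
    rwa [(hu.isClosed_sublevel k).frontier_eq, h, Set.sdiff_empty] at this
  obtain ⟨c, hc⟩ := h4
  obtain ⟨r, hr, hs⟩ := Metric.isOpen_iff.1 isOpen_interior c hc
  refine ⟨c, r, k, hr, fun x hx => ?_⟩
  have : x ∈ {x | u x ≤ ((k : ℝ) : EReal)} := interior_subset (hs hx)
  exact this

/-- Contracting a set towards a point scales its volume by `t ^ n`. -/
lemma volume_homothety (y : Rn n) {t : ℝ} (ht : 0 < t) (A : Set (Rn n)) :
    volume ((fun b => (1 - t) • y + t • b) '' A) = ENNReal.ofReal (t ^ n) * volume A := by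
  have h := Measure.addHaar_image_homothety volume y t A
  rw [finrank_euclideanSpace_fin, abs_of_pos (pow_pos ht n)] at h
  rw [← h]
  congr 1
  refine Set.image_congr' fun b => ?_
  rw [AffineMap.homothety_apply, vsub_eq_sub, vadd_eq_add]
  module

/-- A strong enough contraction of `ball c R` towards any point near `x` ends up near `x`, while the
corresponding convex combination of `s` and `M` stays below `s'`. -/
lemma exists_contraction (x c : Rn n) (R : ℝ) {r s s' M : ℝ} (hr : 0 < r) (hs : s < s') :
    ∃ t : ℝ, 0 < t ∧ t < 1 ∧ (1 - t) * s + t * M < s' ∧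
      ∀ y ∈ Metric.ball x (r / 2), ∀ b ∈ Metric.ball c R,
        (1 - t) • y + t • b ∈ Metric.ball x r := by
  -- Each requirement holds for all small `t > 0`.
  have h1 : ∀ᶠ t in 𝓝[>] (0 : ℝ), (1 - t) * s + t * M < s' := by
    have : Tendsto (fun t : ℝ => (1 - t) * s + t * M) (𝓝[>] 0) (𝓝 ((1 - 0) * s + 0 * M)) :=
      (Continuous.tendsto (by fun_prop) 0).mono_left nhdsWithin_le_nhds
    exact this.eventually_lt_const (by simpa using hs)
  have h2 : ∀ᶠ t in 𝓝[>] (0 : ℝ), t * (R + dist c x) < r / 2 := by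
    have : Tendsto (fun t : ℝ => t * (R + dist c x)) (𝓝[>] 0) (𝓝 (0 * (R + dist c x))) :=
      (Continuous.tendsto (by fun_prop) 0).mono_left nhdsWithin_le_nhds
    exact this.eventually_lt_const (by simpa using hr)
  have h3 : ∀ᶠ t in 𝓝[>] (0 : ℝ), t < 1 :=
    mem_nhdsWithin_of_mem_nhds (gt_mem_nhds one_pos)
  obtain ⟨t, ⟨⟨h1, h2⟩, h3⟩, h4⟩ :=
    (((h1.and h2).and h3).and (self_mem_nhdsWithin : ∀ᶠ t in 𝓝[>] (0 : ℝ), t ∈ Set.Ioi 0)).exists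
  have h4 : 0 < t := h4
  refine ⟨t, h4, h3, h1, fun y hy b hb => ?_⟩
  rw [mem_ball_iff_norm] at *
  have hbx : ‖b - x‖ ≤ R + dist c x := by
    rw [← dist_eq_norm]
    have := dist_triangle b c x
    rw [dist_eq_norm b c] at this
    linarith
  have e : (1 - t) • y + t • b - x = (1 - t) • (y - x) + t • (b - x) := by module
  rw [e]
  calc ‖(1 - t) • (y - x) + t • (b - x)‖ ≤ (1 - t) * ‖y - x‖ + t * ‖b - x‖ := by
        refine (norm_add_le _ _).trans ?_
        rw [norm_smul, norm_smul, Real.norm_of_nonneg (by linarith : 0 ≤ 1 - t),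
          Real.norm_of_nonneg h4.le]
    _ ≤ 1 * ‖y - x‖ + t * (R + dist c x) := by gcongr; linarith
    _ < r := by linarith

/-- Strict sublevel sets are nowhere thin. -/
lemma IsCVcn.volume_pos (hu : IsCVcn u) {x : Rn n} {s : ℝ} (hx : u x < s) {U : Set (Rn n)}
    (hU : U ∈ 𝓝 x) : 0 < volume (U ∩ {y | u y < s}) := by
  obtain ⟨c, R, M, hR, hM⟩ := hu.exists_ball
  obtain ⟨r, hr, hrU⟩ := Metric.mem_nhds_iff.1 hU
  obtain ⟨s₀, hs₀, hs₀'⟩ := EReal.lt_iff_exists_real_btwn.1 hx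
  obtain ⟨t, ht0, ht1, hts, htb⟩ := exists_contraction x c R (M := M) hr
    (EReal.coe_lt_coe_iff.1 hs₀')
  have h := volume_homothety x ht0 (Metric.ball c R)
  have hpos : 0 < ENNReal.ofReal (t ^ n) * volume (Metric.ball c R) :=
    ENNReal.mul_pos (by simpa using pow_pos ht0 n) (Metric.measure_ball_pos volume c hR).ne'
  rw [← h] at hpos
  refine hpos.trans_le (measure_mono ?_)
  rintro _ ⟨b, hb, rfl⟩
  refine ⟨hrU (htb x (Metric.mem_ball_self (by linarith)) b hb), ?_⟩
  exact (hu.le_of_le hs₀.le (hM b hb) (by linarith) ht0 (by ring)).trans_lt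
    (EReal.coe_lt_coe_iff.2 hts)

/-- Two functions which agree almost everywhere agree. -/
lemma IsCVcn.le_of_ae_eq {v : Rn n → EReal} (hu : IsCVcn u) (hv : IsCVcn v)
    (h : u =ᵐ[volume] v) : v ≤ u := by
  intro x
  by_contra! hx
  obtain ⟨s, hs, hs'⟩ := EReal.lt_iff_exists_real_btwn.1 hx
  refine (hu.volume_pos hs (hv.lsc x s hs')).ne' ?_
  refine measure_mono_null ?_ h
  rintro y ⟨hy1, hy2⟩ hy
  have hy1 : (s : EReal) < v y := hy1
  have hy2 : u y < s := hy2
  exact lt_asymm hy1 (hy ▸ hy2)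

lemma IsCVcn.eq_of_ae_eq {v : Rn n → EReal} (hu : IsCVcn u) (hv : IsCVcn v)
    (h : u =ᵐ[volume] v) : u = v :=
  le_antisymm (hv.le_of_ae_eq hu h.symm) (hu.le_of_ae_eq hv h)

end Convex

end EpiMetric

namespace EpiMetric

/-! ### Epi-convergence in terms of neighbourhoods -/

section Epi

variable {n : ℕ} {u : ℕ → Rn n → EReal} {v : Rn n → EReal}

/-- Near every point, the functions `u k` are eventually above every number below the value of `v`
at that point. -/
def EpiLower {n : ℕ} (u : ℕ → Rn n → EReal) (v : Rn n → EReal) : Prop :=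
  ∀ (x : Rn n) (s : ℝ), (s : EReal) < v x → ∀ᶠ z in atTop ×ˢ 𝓝 x, (s : EReal) < u z.1 z.2

/-- In every neighbourhood of a point, the functions `u k` eventually take values below any given
number above the value of `v` at that point. -/
def EpiUpper {n : ℕ} (u : ℕ → Rn n → EReal) (v : Rn n → EReal) : Prop :=
  ∀ (x : Rn n) (s : ℝ), v x < s → ∀ U ∈ 𝓝 x, ∀ᶠ k in atTop, ∃ y ∈ U, u k y < s

/-- A failure yields points tending to `x` with low values along indices tending to infinity. Made
strictly increasing in the index and filled in with `x` elsewhere, they form a full sequence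
violating the liminf condition. -/
lemma EpiConverges.epiLower (h : EpiConverges u v) : EpiLower u v := by
  intro x s hs
  by_contra hcon
  obtain ⟨z, hz, hzs⟩ := exists_seq_forall_of_frequently (not_eventually.1 hcon)
  have hz1 : Tendsto (fun j => (z j).1) atTop atTop := tendsto_fst.comp hz
  have hz2 : Tendsto (fun j => (z j).2) atTop (𝓝 x) := tendsto_snd.comp hz
  obtain ⟨φ, hφ, hzφ⟩ := strictMono_subseq_of_tendsto_atTop hz1
  set κ : ℕ → ℕ := fun j => (z (φ j)).1 with hκ
  have hκm : StrictMono κ := hzφ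
  set y : ℕ → Rn n := Function.extend κ (fun j => (z (φ j)).2) (fun _ => x) with hy
  have hyκ : ∀ j, y (κ j) = (z (φ j)).2 := fun j => hκm.injective.extend_apply _ _ j
  have hyx : Tendsto y atTop (𝓝 x) := by
    intro U hU
    obtain ⟨J, hJ⟩ := eventually_atTop.1 ((hz2.comp hφ.tendsto_atTop).eventually hU)
    refine mem_map.2 (mem_atTop_sets.2 ⟨κ J, fun k hk => ?_⟩)
    change y k ∈ U
    by_cases hk' : ∃ j, κ j = k
    · obtain ⟨j, rfl⟩ := hk'
      rw [hyκ]
      exact hJ j (hκm.le_iff_le.1 hk)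
    · rw [hy, Function.extend_apply' _ _ _ hk']
      exact mem_of_mem_nhds hU
  refine absurd ((h x).1 y hyx) (not_le.2 (lt_of_le_of_lt ?_ hs))
  refine liminf_le_of_frequently_le ?_
  refine frequently_atTop.2 fun a => ⟨κ a, hκm.id_le a, ?_⟩
  rw [hyκ]
  exact not_lt.1 (hzs (φ a))

lemma EpiConverges.epiUpper (h : EpiConverges u v) : EpiUpper u v := by
  intro x s hs U hU
  obtain ⟨y, hy, hyl⟩ := (h x).2
  filter_upwards [hy.eventually hU, eventually_lt_of_limsup_lt (hyl.trans_lt hs)] with k hk1 hk2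
  exact ⟨y k, hk1, hk2⟩

/-- Diagonal selection. -/
lemma exists_diagonal {P : ℕ → ℕ → Prop} (hP : ∀ m, ∀ᶠ k in atTop, P m k) :
    ∃ m : ℕ → ℕ, Tendsto m atTop atTop ∧ ∀ᶠ k in atTop, P (m k) k := by
  classical
  -- The cap `m ≤ k` keeps the search finite; `P 0 k`, eventually true, makes it succeed.
  refine ⟨fun k => Nat.findGreatest (fun m => P m k) k, tendsto_atTop.2 fun a => ?_, ?_⟩
  · filter_upwards [hP a, eventually_ge_atTop a] with k hk1 hk2
    exact Nat.le_findGreatest hk2 hk1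
  · filter_upwards [hP 0] with k hk
    exact Nat.findGreatest_spec (P := fun m => P m k) (Nat.zero_le k) hk

lemma EpiUpper.exists_recovery (h : EpiUpper u v) (hv : ∀ x, v x ≠ ⊥) (x : Rn n) :
    ∃ y : ℕ → Rn n, Tendsto y atTop (𝓝 x) ∧ limsup (fun k => u k (y k)) atTop ≤ v x := by
  by_cases hx : v x = ⊤
  · exact ⟨fun _ => x, tendsto_const_nhds, by simp [hx]⟩
  obtain ⟨r, hr⟩ : ∃ r : ℝ, v x = r := ⟨(v x).toReal, (EReal.coe_toReal hx (hv x)).symm⟩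
  have hpos : ∀ m : ℕ, (0 : ℝ) < 1 / ((m : ℝ) + 1) := fun m => Nat.one_div_pos_of_nat
  obtain ⟨m, hm, hmP⟩ := exists_diagonal (P := fun m k =>
      ∃ y ∈ Metric.ball x (1 / ((m : ℝ) + 1)), u k y < ((r + 1 / ((m : ℝ) + 1) : ℝ) : EReal))
    fun m => h x _ (by rw [hr]; exact EReal.coe_lt_coe_iff.2 (by linarith [hpos m])) _
      (Metric.ball_mem_nhds x (hpos m))
  have h0 : Tendsto (fun k => 1 / ((m k : ℝ) + 1)) atTop (𝓝 0) :=
    tendsto_one_div_add_atTop_nhds_zero_nat.comp hm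
  have : ∀ k, ∃ y, (∃ y ∈ Metric.ball x (1 / ((m k : ℝ) + 1)),
      u k y < ((r + 1 / ((m k : ℝ) + 1) : ℝ) : EReal)) →
      (y ∈ Metric.ball x (1 / ((m k : ℝ) + 1)) ∧
        u k y < ((r + 1 / ((m k : ℝ) + 1) : ℝ) : EReal)) := by
    intro k
    by_cases hk : ∃ y ∈ Metric.ball x (1 / ((m k : ℝ) + 1)),
      u k y < ((r + 1 / ((m k : ℝ) + 1) : ℝ) : EReal)
    · obtain ⟨y, hy⟩ := hk
      exact ⟨y, fun _ => hy⟩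
    · exact ⟨x, fun h => absurd h hk⟩
  choose y hy using this
  have hy' := hmP.mono fun k hk => hy k hk
  refine ⟨y, ?_, ?_⟩
  · rw [tendsto_iff_dist_tendsto_zero]
    refine tendsto_of_tendsto_of_tendsto_of_le_of_le' tendsto_const_nhds h0
      (Eventually.of_forall fun _ => dist_nonneg) (hy'.mono fun k hk => ?_)
    exact (Metric.mem_ball.1 hk.1).le
  · rw [hr, ← EReal.le_of_forall_lt_iff_le]
    intro z hz
    have hz : r < z := EReal.coe_lt_coe_iff.1 hz
    refine limsup_le_of_le (h := ?_)
    filter_upwards [hy', h0.eventually_lt_const (sub_pos.2 hz)] with k hk1 hk2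
    exact hk1.2.le.trans (EReal.coe_le_coe_iff.2 (by linarith))

lemma epiConverges_of_lower_of_upper (hv : ∀ x, v x ≠ ⊥) (hl : EpiLower u v)
    (hu : EpiUpper u v) : EpiConverges u v := by
  refine fun x => ⟨fun y hy => ?_, hu.exists_recovery hv x⟩
  rw [← EReal.ge_of_forall_gt_iff_ge]
  intro z hz
  refine le_liminf_of_le (h := ?_)
  exact ((tendsto_id.prodMk hy).eventually (hl x z hz)).mono fun k hk => le_of_lt hk

/-- Constant sequences let `exists_uniform_cone` also produce a cone below a single function. -/
lemma IsCVcn.epiLower_const (hv : IsCVcn v) : EpiLower (fun _ => v) v := fun x s hs =>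
  (tendsto_snd (f := (atTop : Filter ℕ))).eventually (hv.lsc x s hs)

lemma epiUpper_const : EpiUpper (fun _ => v) v := fun x _ hs _ hU =>
  Eventually.of_forall fun _ => ⟨x, mem_of_mem_nhds hU, hs⟩

lemma eventually_forall_mem_of_isCompact {ι X : Type*} [TopologicalSpace X] {l : Filter ι}
    {K : Set X} (hK : IsCompact K) {P : ι → X → Prop}
    (h : ∀ x ∈ K, ∀ᶠ z in l ×ˢ 𝓝 x, P z.1 z.2) : ∀ᶠ i in l, ∀ x ∈ K, P i x := by
  refine hK.induction_on (p := fun S => ∀ᶠ i in l, ∀ x ∈ S, P i x) ?_ ?_ ?_ ?_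
  · simp
  · exact fun S T hST hT => hT.mono fun i hi x hx => hi x (hST hx)
  · intro S T hS hT
    filter_upwards [hS, hT] with i hi hi' x hx
    exact hx.elim (hi x) (hi' x)
  · intro x hx
    obtain ⟨pa, ha, pb, hb, hab⟩ := eventually_prod_iff.1 (h x hx)
    exact ⟨{y | pb y}, mem_nhdsWithin_of_mem_nhds hb, ha.mono fun i hi y hy => hab hi hy⟩

/-- Epi-convergent sequences have a common affine minorant in the norm. -/
lemma exists_uniform_cone (hu : ∀ k, IsCVcn (u k)) (hv : IsCVcn v) (hl : EpiLower u v)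
    (hup : EpiUpper u v) :
    ∃ a b : ℝ, 0 < a ∧ ∀ᶠ k in atTop, ∀ x, ((a * ‖x‖ - b : ℝ) : EReal) ≤ u k x := by
  obtain ⟨x₀, hx₀⟩ := hv.proper
  obtain ⟨M, hM, -⟩ := EReal.lt_iff_exists_real_btwn.1 (lt_top_iff_ne_top.2 hx₀)
  obtain ⟨R, -, hR⟩ := hasBasis_cobounded_norm.eventually_iff.1
    (hv.coercive.eventually (lt_mem_nhds (EReal.coe_lt_top (M + 1))))
  -- Points at distance at least `ρ - 1` from `x₀` have norm at least `R`. The shell has margin 1 on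
  -- both sides because `y` below is only known to within 1 of `x₀`.
  set ρ : ℝ := max R 0 + ‖x₀‖ + 2 with hρ
  have hρR : R + ‖x₀‖ + 2 ≤ ρ := by linarith [le_max_left R 0]
  have hρ0 : 0 < ρ := by linarith [le_max_right R 0, norm_nonneg x₀]
  have hK1 : IsCompact (Metric.closedBall x₀ (ρ + 1)) := isCompact_closedBall _ _
  have hK2 : IsCompact (Metric.closedBall x₀ (ρ + 1) \ Metric.ball x₀ (ρ - 1)) :=
    hK1.diff Metric.isOpen_ball
  obtain ⟨z₀, -, hz₀⟩ := (hv.lsc.lowerSemicontinuousOn _).exists_isMinOn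
    ⟨x₀, Metric.mem_closedBall_self (by linarith)⟩ hK1
  obtain ⟨s₀, -, hs₀⟩ := EReal.lt_iff_exists_real_btwn.1 (bot_lt_iff_ne_bot.2 (hv.ne_bot z₀))
  have e1 : ∀ᶠ k in atTop, ∀ x ∈ Metric.closedBall x₀ (ρ + 1), (s₀ : EReal) < u k x :=
    eventually_forall_mem_of_isCompact hK1 fun x hx => hl x s₀ (hs₀.trans_le (hz₀ hx))
  have e2 : ∀ᶠ k in atTop, ∀ x ∈ Metric.closedBall x₀ (ρ + 1) \ Metric.ball x₀ (ρ - 1),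
      ((M + 1 : ℝ) : EReal) < u k x := by
    refine eventually_forall_mem_of_isCompact hK2 fun x hx => hl x (M + 1) (hR ?_)
    have h1 : ρ - 1 ≤ dist x x₀ := not_lt.1 hx.2
    rw [dist_eq_norm] at h1
    have h2 := norm_sub_le x x₀
    change R ≤ ‖x‖
    linarith
  have e3 := hup x₀ M hM _ (Metric.ball_mem_nhds x₀ one_pos)
  refine ⟨1 / ρ, max (1 / ρ * (‖x₀‖ + 1) - M) (1 / ρ * (‖x₀‖ + ρ + 1) - s₀), by positivity, ?_⟩
  filter_upwards [e1, e2, e3] with k h1 h2 ⟨y, hy, hyM⟩ x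
  have hy : dist y x₀ < 1 := hy
  have hyx : ‖y‖ ≤ ‖x₀‖ + 1 := by
    have := norm_le_norm_add_norm_sub x₀ y
    rw [← dist_eq_norm] at this
    linarith [dist_comm x₀ y]
  by_cases hx : dist x y ≤ ρ
  · have hxm : x ∈ Metric.closedBall x₀ (ρ + 1) := by
      rw [Metric.mem_closedBall]
      linarith [dist_triangle x y x₀]
    refine le_trans (EReal.coe_le_coe_iff.2 ?_) (h1 x hxm).le
    have hxn : ‖x‖ ≤ ‖x₀‖ + ρ + 1 := by
      have := norm_le_norm_add_norm_sub x₀ x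
      rw [← dist_eq_norm, dist_comm] at this
      linarith [Metric.mem_closedBall.1 hxm, dist_comm x₀ x]
    have := mul_le_mul_of_nonneg_left hxn (by positivity : 0 ≤ 1 / ρ)
    linarith [le_max_right (1 / ρ * (‖x₀‖ + 1) - M) (1 / ρ * (‖x₀‖ + ρ + 1) - s₀)]
  · rw [not_le] at hx
    have hd : 0 < dist x y := hρ0.trans hx
    set t : ℝ := ρ / dist x y with ht
    have ht0 : 0 < t := by positivity
    have ht1 : t < 1 := (div_lt_one hd).2 hx
    -- The point of the segment from `y` to `x` at distance `ρ` from `y` lies in the shell. There `u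
    -- k` has risen by more than 1 above `M`, so by convexity it keeps a slope of at least `1 / ρ`
    -- up to `x`.
    have key : ((M + 1 / t : ℝ) : EReal) ≤ u k x := by
      by_contra! hlt
      have hz := (hu k).le_of_le hyM.le hlt.le (sub_pos.2 ht1) ht0 (by ring)
      have e : (1 - t) * M + t * (M + 1 / t) = M + 1 := by field_simp; ring
      rw [e] at hz
      refine absurd (h2 _ ⟨?_, ?_⟩) (not_lt.2 hz)
      all_goals
        have hdz : dist ((1 - t) • y + t • x) y = ρ := by
          rw [dist_eq_norm, show (1 - t) • y + t • x - y = t • (x - y) by module, norm_smul,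
            Real.norm_of_nonneg ht0.le, ← dist_eq_norm, ht, div_mul_cancel₀ _ hd.ne']
      · rw [Metric.mem_closedBall]
        linarith [dist_triangle ((1 - t) • y + t • x) y x₀]
      · rw [Metric.mem_ball, not_lt]
        linarith [dist_triangle ((1 - t) • y + t • x) x₀ y, dist_comm y x₀]
    refine le_trans (EReal.coe_le_coe_iff.2 ?_) key
    have h1t : 1 / t = 1 / ρ * dist x y := by rw [ht]; field_simp
    have hxn : ‖x‖ ≤ dist x y + (‖x₀‖ + 1) := by
      have := norm_le_norm_add_norm_sub y x
      rw [← dist_eq_norm, dist_comm] at this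
      linarith [dist_comm x y]
    have := mul_le_mul_of_nonneg_left hxn (by positivity : 0 ≤ 1 / ρ)
    rw [h1t]
    linarith [le_max_left (1 / ρ * (‖x₀‖ + 1) - M) (1 / ρ * (‖x₀‖ + ρ + 1) - s₀)]

/-- A closed convex set which comes close to all points of a ball contains its centre. -/
lemma mem_of_forall_exists_dist_lt {C : Set (Rn n)} (hC : Convex ℝ C) (hC' : IsClosed C)
    {x : Rn n} {r : ℝ} (hr : 0 < r)
    (h : ∀ y ∈ Metric.closedBall x r, ∃ z ∈ C, dist z y < r) : x ∈ C := by
  by_contra hx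
  obtain ⟨f, c, hf, hc⟩ := geometric_hahn_banach_closed_point hC hC' hx
  set w := (InnerProductSpace.toDual ℝ (Rn n)).symm f with hw
  have hfw : ∀ a, f a = inner ℝ w a := fun a => InnerProductSpace.toDual_symm_apply.symm
  by_cases hw0 : w = 0
  · obtain ⟨z, hz, -⟩ := h x (Metric.mem_closedBall_self hr.le)
    have h1 := (hf z hz).trans hc
    rw [hfw, hfw, hw0, inner_zero_left, inner_zero_left] at h1
    exact lt_irrefl _ h1
  have hwn : 0 < ‖w‖ := norm_pos_iff.2 hw0
  -- This point lies `r` beyond `x` in the separating direction, so everything within `r` of it is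
  -- on the wrong side of the hyperplane.
  obtain ⟨z, hz, hzy⟩ := h (x + (r / ‖w‖) • w) (by
    rw [mem_closedBall_iff_norm, add_sub_cancel_left, norm_smul, Real.norm_of_nonneg
      (by positivity), div_mul_cancel₀ _ hwn.ne'])
  have h1 := (hf z hz).trans hc
  rw [hfw, hfw] at h1
  have h2 : inner ℝ w z = inner ℝ w x + r * ‖w‖ + inner ℝ w (z - (x + (r / ‖w‖) • w)) := by
    rw [inner_sub_right, inner_add_right, inner_smul_right, real_inner_self_eq_norm_sq]
    field_simp
    ring
  have h3 := neg_le_of_abs_le (abs_real_inner_le_norm w (z - (x + (r / ‖w‖) • w)))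
  rw [← dist_eq_norm] at h3
  nlinarith

/-- `EpiUpper` gives low values only near each point. By compactness the sublevel set of `u k` comes
close to a whole ball around `x`, and being closed and convex it contains `x`. -/
lemma eventually_le_of_mem_interior (hu : ∀ k, IsCVcn (u k)) (hup : EpiUpper u v) {x : Rn n}
    {q s : ℝ} (hq : q < s) (hx : x ∈ interior {y | v y ≤ q}) : ∀ᶠ k in atTop, u k x ≤ s := by
  obtain ⟨r₀, hr₀, hb⟩ := Metric.isOpen_iff.1 isOpen_interior x hx
  set r := r₀ / 2 with hr
  have hr0 : 0 < r := by positivity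
  have hK := eventually_forall_mem_of_isCompact (l := atTop)
    (P := fun k y => ∃ z ∈ {z | u k z ≤ s}, dist z y < r)
    (isCompact_closedBall x r) (fun y hy => by
      have hyq : y ∈ {y | v y ≤ q} :=
        interior_subset (hb (Metric.closedBall_subset_ball (by linarith) hy))
      have hyq : v y < s := lt_of_le_of_lt hyq (EReal.coe_lt_coe_iff.2 hq)
      have h1 := hup y s hyq _ (Metric.ball_mem_nhds y (half_pos hr0))
      filter_upwards [h1.prod_mk (Metric.ball_mem_nhds y (half_pos hr0))] with ⟨k, a⟩ ⟨h1, h2⟩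
      obtain ⟨z, hz1, hz2⟩ := h1
      refine ⟨z, hz2.le, ?_⟩
      have hz1 : dist z y < r / 2 := hz1
      have h2 : dist a y < r / 2 := h2
      change dist z a < r
      linarith [dist_triangle_right z a y])
  filter_upwards [hK] with k hk
  exact mem_of_forall_exists_dist_lt ((hu k).convex_sublevel s) ((hu k).isClosed_sublevel s) hr0 hk

/-- Epi-convergence implies convergence almost everywhere. -/
lemma ae_tendsto_of_epi (hu : ∀ k, IsCVcn (u k)) (hv : IsCVcn v) (hl : EpiLower u v)
    (hup : EpiUpper u v) : ∀ᵐ x, Tendsto (fun k => u k x) atTop (𝓝 (v x)) := by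
  -- Off these countably many null frontiers, `v x ≤ q` puts `x` in the interior of the sublevel
  -- set.
  have h0 : ∀ᵐ x, ∀ q : ℚ, x ∉ frontier {y | v y ≤ ((q : ℝ) : EReal)} :=
    ae_all_iff.2 fun q => measure_eq_zero_iff_ae_notMem.1
      ((hv.convex_sublevel q).addHaar_frontier volume)
  filter_upwards [h0] with x hx
  rw [tendsto_order]
  constructor
  · intro a ha
    obtain ⟨s, hs, hs'⟩ := EReal.lt_iff_exists_real_btwn.1 ha
    have : Tendsto (fun k : ℕ => (k, x)) atTop (atTop ×ˢ 𝓝 x) :=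
      tendsto_id.prodMk tendsto_const_nhds
    exact (this.eventually (hl x s hs')).mono fun k hk => hs.trans hk
  · intro a ha
    obtain ⟨s, hs, hs'⟩ := EReal.lt_iff_exists_real_btwn.1 ha
    obtain ⟨q, hq, hq'⟩ := EReal.lt_iff_exists_rat_btwn.1 hs
    have hq' : ((q : ℝ) : EReal) < s := hq'
    have hxi : x ∈ interior {y | v y ≤ ((q : ℝ) : EReal)} := by
      have h1 : x ∈ {y | v y ≤ ((q : ℝ) : EReal)} := hq.le
      by_contra h2
      exact hx q ⟨subset_closure h1, h2⟩
    exact (eventually_le_of_mem_interior hu hup (EReal.coe_lt_coe_iff.1 hq') hxi).mono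
      fun k hk => hk.trans_lt hs'

end Epi

end EpiMetric

namespace EpiMetric

/-! ### The metric -/

section Metric

variable {ζ : ℝ → ℝ} {p : ℝ} {n : ℕ}

lemma IsMom.abs_sub_rpow_le (hζ : IsMom p n ζ) (hp : 1 ≤ p) {s t : EReal} {r : ℝ}
    (hs : (r : EReal) ≤ s) (ht : (r : EReal) ≤ t) :
    |zetaVal ζ s - zetaVal ζ t| ^ p ≤ ζ r ^ p := by
  have h1 := hζ.zetaVal_le (EReal.coe_ne_bot r) hs
  have h2 := hζ.zetaVal_le (EReal.coe_ne_bot r) ht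
  rw [zetaVal_coe] at h1 h2
  have h3 := hζ.zetaVal_nonneg s
  have h4 := hζ.zetaVal_nonneg t
  refine Real.rpow_le_rpow (abs_nonneg _) ?_ (by linarith)
  rw [abs_le]
  constructor <;> linarith

lemma IsMom.measurable_comp (hζ : IsMom p n ζ) {u : Rn n → EReal} (hu : IsCVcn u) :
    Measurable fun x => zetaVal ζ (u x) :=
  hζ.measurable_zetaVal.comp hu.lsc.measurable

lemma IsCVcn.exists_cone {u : Rn n → EReal} (hu : IsCVcn u) :
    ∃ a b : ℝ, 0 < a ∧ ∀ x, ((a * ‖x‖ - b : ℝ) : EReal) ≤ u x := by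
  obtain ⟨a, b, ha, h⟩ :=
    exists_uniform_cone (fun _ => hu) hu hu.epiLower_const epiUpper_const
  exact ⟨a, b, ha, h.exists.choose_spec⟩

lemma IsMom.memLp (hζ : IsMom p n ζ) (hn : 1 ≤ n) (hp : 1 ≤ p) {u : Rn n → EReal}
    (hu : IsCVcn u) : MemLp (fun x => zetaVal ζ (u x)) (ENNReal.ofReal p) volume := by
  have hp0 : 0 < p := by linarith
  obtain ⟨a, b, ha, hab⟩ := hu.exists_cone
  have hm := hζ.measurable_comp hu
  rw [← integrable_norm_rpow_iff hm.aestronglyMeasurable (by simpa using hp0)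
    ENNReal.ofReal_ne_top, ENNReal.toReal_ofReal hp0.le]
  refine (hζ.integrable_cone hn hp ha b).mono' (hm.norm.pow_const p).aestronglyMeasurable
    (Eventually.of_forall fun x => ?_)
  have := hζ.abs_sub_rpow_le hp (hab x) le_top
  rw [zetaVal_top, sub_zero] at this
  rwa [Real.norm_of_nonneg (Real.rpow_nonneg (norm_nonneg _) p), Real.norm_eq_abs]

lemma IsMom.integrable_abs_sub_rpow (hζ : IsMom p n ζ) (hn : 1 ≤ n) (hp : 1 ≤ p)
    {u v : Rn n → EReal} (hu : IsCVcn u) (hv : IsCVcn v) :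
    Integrable (fun x => |zetaVal ζ (u x) - zetaVal ζ (v x)| ^ p) := by
  have hp0 : 0 < p := by linarith
  have h := ((hζ.memLp hn hp hu).sub (hζ.memLp hn hp hv)).integrable_norm_rpow
    (by simpa using hp0) ENNReal.ofReal_ne_top
  rw [ENNReal.toReal_ofReal hp0.le] at h
  exact h

/-- The metric is pulled back from `Lp`, so the triangle inequality is Minkowski's. -/
lemma IsMom.exists_metricSpace (hζ : IsMom p n ζ) (hn : 1 ≤ n) (hp : 1 ≤ p) :
    ∃ m : MetricSpace (CVcn n), ∀ u v, m.dist u v = delta ζ p u v := by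
  have hp0 : 0 < p := by linarith
  have : Fact (1 ≤ ENNReal.ofReal p) := ⟨by simpa using ENNReal.ofReal_le_ofReal hp⟩
  set F : CVcn n → Lp ℝ (ENNReal.ofReal p) (volume : Measure (Rn n)) :=
    fun u => (hζ.memLp hn hp u.2).toLp with hF
  have hinj : Function.Injective F := by
    intro u v huv
    rw [hF] at huv
    have h1 := (MemLp.toLp_eq_toLp_iff _ _).1 huv
    refine Subtype.ext (u.2.eq_of_ae_eq v.2 ?_)
    filter_upwards [h1] with x hx
    exact hζ.zetaVal_injOn (u.2.ne_bot x) (v.2.ne_bot x) hx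
  refine ⟨MetricSpace.induced F hinj inferInstance, fun u v => ?_⟩
  change dist (F u) (F v) = _
  have hsub := (hζ.memLp hn hp u.2).sub (hζ.memLp hn hp v.2)
  rw [dist_edist, hF, Lp.edist_toLp_toLp,
    hsub.eLpNorm_eq_integral_rpow_norm (by simpa using hp0) ENNReal.ofReal_ne_top,
    ENNReal.toReal_ofReal hp0.le, ENNReal.toReal_ofReal (Real.rpow_nonneg
      (integral_nonneg fun _ => Real.rpow_nonneg (norm_nonneg _) _) _), delta, one_div]
  rfl

lemma tendsto_delta_iff (hp : 1 ≤ p) (u : ℕ → CVcn n) (v : CVcn n) :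
    Tendsto (fun k => delta ζ p (u k) v) atTop (𝓝 0) ↔
      Tendsto (fun k => ∫ x, |zetaVal ζ (u k x) - zetaVal ζ (v x)| ^ p) atTop (𝓝 0) := by
  have hp0 : 0 < p := by linarith
  have hI : ∀ k, 0 ≤ ∫ x, |zetaVal ζ (u k x) - zetaVal ζ (v x)| ^ p := fun k =>
    integral_nonneg fun _ => Real.rpow_nonneg (abs_nonneg _) _
  constructor
  · intro h
    have h1 := h.rpow_const (p := p) (Or.inr hp0.le)
    rw [Real.zero_rpow hp0.ne'] at h1
    refine h1.congr fun k => ?_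
    rw [delta, ← Real.rpow_mul (hI k), one_div_mul_cancel hp0.ne', Real.rpow_one]
  · intro h
    have h1 := h.rpow_const (p := 1 / p) (Or.inr (by positivity))
    rwa [Real.zero_rpow (by positivity)] at h1

lemma IsMom.tendsto_delta_of_epi (hζ : IsMom p n ζ) (hn : 1 ≤ n) (hp : 1 ≤ p) {u : ℕ → CVcn n}
    {v : CVcn n} (h : EpiConverges (fun k => u k) v) :
    Tendsto (fun k => delta ζ p (u k) v) atTop (𝓝 0) := by
  have hp0 : 0 < p := by linarith
  have hu : ∀ k, IsCVcn (u k) := fun k => (u k).2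
  rw [tendsto_delta_iff hp]
  obtain ⟨a, b, ha, hab⟩ := exists_uniform_cone hu v.2 h.epiLower h.epiUpper
  -- The smaller slope and larger offset give one cone below `v` and all late `u k`.
  obtain ⟨a', b', ha', hab'⟩ := v.2.exists_cone
  set g : Rn n → ℝ := fun x => ζ (min a a' * ‖x‖ - max b b') ^ p with hg
  have hle : ∀ x : Rn n, min a a' * ‖x‖ - max b b' ≤ a * ‖x‖ - b := fun x =>
    sub_le_sub (mul_le_mul_of_nonneg_right (min_le_left _ _) (norm_nonneg x)) (le_max_left _ _)
  have hle' : ∀ x : Rn n, min a a' * ‖x‖ - max b b' ≤ a' * ‖x‖ - b' := fun x =>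
    sub_le_sub (mul_le_mul_of_nonneg_right (min_le_right _ _) (norm_nonneg x)) (le_max_right _ _)
  have hlim := tendsto_integral_filter_of_dominated_convergence (μ := volume) (l := atTop)
    (F := fun k x => |zetaVal ζ (u k x) - zetaVal ζ (v x)| ^ p) (f := fun _ => (0 : ℝ)) g
    (Eventually.of_forall fun k =>
      (hζ.integrable_abs_sub_rpow hn hp (hu k) v.2).aestronglyMeasurable) ?_
    (hζ.integrable_cone hn hp (lt_min ha ha') _) ?_
  · simpa using hlim
  · filter_upwards [hab] with k hk
    refine Eventually.of_forall fun x => ?_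
    rw [Real.norm_of_nonneg (Real.rpow_nonneg (abs_nonneg _) _)]
    exact hζ.abs_sub_rpow_le hp ((EReal.coe_le_coe_iff.2 (hle x)).trans (hk x))
      ((EReal.coe_le_coe_iff.2 (hle' x)).trans (hab' x))
  · filter_upwards [ae_tendsto_of_epi hu v.2 h.epiLower h.epiUpper] with x hx
    have h1 := (hζ.continuousAt_zetaVal hp (v.2.ne_bot x)).tendsto.comp hx
    have h2 := ((h1.sub_const (zetaVal ζ (v x))).abs).rpow_const (p := p) (Or.inr hp0.le)
    rw [sub_self, abs_zero, Real.zero_rpow hp0.ne'] at h2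
    exact h2

/-- Convergence in the metric implies convergence in measure. -/
lemma IsMom.tendsto_volume (hζ : IsMom p n ζ) (hn : 1 ≤ n) (hp : 1 ≤ p) {u : ℕ → CVcn n}
    {v : CVcn n} (h : Tendsto (fun k => delta ζ p (u k) v) atTop (𝓝 0)) {η : ℝ} (hη : 0 < η)
    {c : ENNReal} (hc : 0 < c) :
    ∀ᶠ k in atTop, volume {x | η ≤ |zetaVal ζ (u k x) - zetaVal ζ (v x)|} < c := by
  have hp0 : 0 < p := by linarith
  rw [tendsto_delta_iff hp] at h
  have hηp : 0 < η ^ p := Real.rpow_pos_of_pos hη p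
  have h1 : Tendsto (fun k => ENNReal.ofReal
      ((∫ x, |zetaVal ζ (u k x) - zetaVal ζ (v x)| ^ p) / η ^ p)) atTop (𝓝 0) := by
    have := ENNReal.tendsto_ofReal (h.div_const (η ^ p))
    rwa [zero_div, ENNReal.ofReal_zero] at this
  filter_upwards [h1.eventually_lt_const hc] with k hk
  refine lt_of_le_of_lt ?_ hk
  have hint := hζ.integrable_abs_sub_rpow hn hp (u k).2 v.2
  have hmar := mul_meas_ge_le_integral_of_nonneg
    (Eventually.of_forall fun x => Real.rpow_nonneg (abs_nonneg _) _) hint (η ^ p)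
  have hfin := hint.measure_ge_lt_top hηp
  calc volume {x | η ≤ |zetaVal ζ (u k x) - zetaVal ζ (v x)|}
      ≤ volume {x | η ^ p ≤ |zetaVal ζ (u k x) - zetaVal ζ (v x)| ^ p} :=
        measure_mono fun x (hx : η ≤ _) => Real.rpow_le_rpow hη.le hx hp0.le
    _ = ENNReal.ofReal (volume.real {x | η ^ p ≤ |zetaVal ζ (u k x) - zetaVal ζ (v x)| ^ p}) :=
        (ofReal_measureReal hfin.ne).symm
    _ ≤ _ := ENNReal.ofReal_le_ofReal ((le_div_iff₀' hηp).2 hmar)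

/-- If `u k ≥ s'` on all of `U`, the integrand is bounded below on `U ∩ {v < s}`, a set of positive
volume independent of `k`. -/
lemma IsMom.epiUpper_of_tendsto (hζ : IsMom p n ζ) (hn : 1 ≤ n) (hp : 1 ≤ p) {u : ℕ → CVcn n}
    {v : CVcn n} (h : Tendsto (fun k => delta ζ p (u k) v) atTop (𝓝 0)) :
    EpiUpper (fun k => u k) v := by
  intro x s' hs' U hU
  obtain ⟨s, hs, hss⟩ := EReal.lt_iff_exists_real_btwn.1 hs'
  have hss : s < s' := EReal.coe_lt_coe_iff.1 hss
  filter_upwards [hζ.tendsto_volume hn hp h (sub_pos.2 (hζ.anti hss)) (v.2.volume_pos hs hU)]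
    with k hk
  by_contra! hcon
  refine absurd hk (not_lt.2 (measure_mono ?_))
  rintro y ⟨hyU, hys⟩
  have hys : v y < s := hys
  have h1 := hζ.zetaVal_le (EReal.coe_ne_bot s') (hcon y hyU)
  have h2 := hζ.zetaVal_le (v.2.ne_bot y) hys.le
  rw [zetaVal_coe] at h1 h2
  change ζ s - ζ s' ≤ |_|
  rw [abs_sub_comm]
  exact le_trans (by linarith) (le_abs_self _)

lemma IsMom.epiLower_of_tendsto (hζ : IsMom p n ζ) (hn : 1 ≤ n) (hp : 1 ≤ p) {u : ℕ → CVcn n}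
    {v : CVcn n} (h : Tendsto (fun k => delta ζ p (u k) v) atTop (𝓝 0)) :
    EpiLower (fun k => u k) v := by
  intro x s hs
  obtain ⟨s₂, hs₂, hs₂v⟩ := EReal.lt_iff_exists_real_btwn.1 hs
  obtain ⟨s₁, hs₁, hs₁₂⟩ := exists_between (EReal.coe_lt_coe_iff.1 hs₂)
  obtain ⟨c, R, M, hR, hM⟩ := v.2.exists_ball
  obtain ⟨r, hr, hrv⟩ := Metric.mem_nhds_iff.1 (v.2.lsc x s₂ hs₂v)
  obtain ⟨t, ht0, ht1, hts, htb⟩ := exists_contraction x c R (M := M + 1) hr hs₁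
  set B := Metric.ball c R with hB
  have hBpos : 0 < volume B := Metric.measure_ball_pos volume c hR
  have htn : 0 < ENNReal.ofReal (t ^ n) := by simpa using pow_pos ht0 n
  have hhalf : 0 < volume B / 2 := ENNReal.half_pos hBpos.ne'
  have e1 := hζ.tendsto_volume hn hp h (sub_pos.2 (hζ.anti (lt_add_one M))) hhalf
  have e2 := hζ.tendsto_volume hn hp h (sub_pos.2 (hζ.anti hs₁₂))
    (ENNReal.mul_pos htn.ne' hhalf.ne')
  filter_upwards [(e1.and e2).prod_mk (Metric.ball_mem_nhds x (half_pos hr))]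
    with ⟨k, y⟩ ⟨⟨h1, h2⟩, hy⟩
  by_contra! hcon
  simp only at hcon h1 h2 hy
  set A := B ∩ {b | u k b ≤ ((M + 1 : ℝ) : EReal)} with hA
  -- On `B \ A` the values of `v` and `u k` are separated by `M` and `M + 1`, so this part has less
  -- than half the volume.
  have hAB : volume B / 2 ≤ volume A := by
    have hsub : B ⊆ A ∪ {x | ζ M - ζ (M + 1) ≤ |zetaVal ζ (u k x) - zetaVal ζ (v x)|} := by
      intro b hb
      by_cases hbA : u k b ≤ ((M + 1 : ℝ) : EReal)
      · exact Or.inl ⟨hb, hbA⟩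
      · right
        have h3 := hζ.zetaVal_le (EReal.coe_ne_bot _) (not_le.1 hbA).le
        have h4 := hζ.zetaVal_le (v.2.ne_bot b) (hM b hb)
        rw [zetaVal_coe] at h3 h4
        change ζ M - ζ (M + 1) ≤ |_|
        rw [abs_sub_comm]
        exact le_trans (by linarith) (le_abs_self _)
    by_contra! hlt
    have := (measure_mono (μ := volume) hsub).trans (measure_union_le _ _)
    refine absurd this (not_le.2 ?_)
    calc _ < volume B / 2 + volume B / 2 := ENNReal.add_lt_add hlt h1
      _ = volume B := ENNReal.add_halves _
  refine absurd h2 (not_lt.2 ?_)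
  -- On the copy of `A` contracted towards `y`, convexity gives `u k ≤ s₁` while `v > s₂`; its
  -- volume exceeds what convergence in measure allows.
  calc ENNReal.ofReal (t ^ n) * (volume B / 2) ≤ ENNReal.ofReal (t ^ n) * volume A := by gcongr
    _ = volume ((fun b => (1 - t) • y + t • b) '' A) := (volume_homothety y ht0 A).symm
    _ ≤ _ := by
      refine measure_mono ?_
      rintro _ ⟨b, ⟨hbB, hbA⟩, rfl⟩
      have h3 : (s₂ : EReal) < v ((1 - t) • y + t • b) := hrv (htb y hy b hbB)
      have h4 := (u k).2.le_of_le (a := 1 - t) hcon hbA (by linarith) ht0 (by ring)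
      have h4 := h4.trans (EReal.coe_le_coe_iff.2 hts.le)
      have h5 := hζ.zetaVal_le ((u k).2.ne_bot _) h4
      have h6 := hζ.zetaVal_le (EReal.coe_ne_bot _) h3.le
      rw [zetaVal_coe] at h5 h6
      change ζ s₁ - ζ s₂ ≤ |_|
      exact le_trans (by linarith) (le_abs_self _)

end Metric

end EpiMetric

theorem theorem1 (n : ℕ) (hn : 1 ≤ n) (p : ℝ) (hp : 1 ≤ p) (ζ : ℝ → ℝ)
    (hζ : EpiMetric.IsMom p n ζ) :
    -- the integral defining `δ_{ζ,p}` is finite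
    (∀ u v : EpiMetric.CVcn n, Integrable
      (fun x => |EpiMetric.zetaVal ζ (u x) - EpiMetric.zetaVal ζ (v x)| ^ p) volume) ∧
    -- `δ_{ζ,p}` is a metric
    (∃ m : MetricSpace (EpiMetric.CVcn n), ∀ u v, m.dist u v = EpiMetric.delta ζ p u v) ∧
    -- convergence in this metric is epi-convergence
    (∀ (u : ℕ → EpiMetric.CVcn n) (v : EpiMetric.CVcn n),
      Tendsto (fun k => EpiMetric.delta ζ p (u k) v) atTop (𝓝 0) ↔
        EpiMetric.EpiConverges (fun k => u k) v) := by
  refine ⟨fun u v => hζ.integrable_abs_sub_rpow hn hp u.2 v.2, hζ.exists_metricSpace hn hp,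
    fun u v => ⟨fun h => ?_, hζ.tendsto_delta_of_epi hn hp⟩⟩
  exact EpiMetric.epiConverges_of_lower_of_upper v.2.ne_bot (hζ.epiLower_of_tendsto hn hp h)
    (hζ.epiUpper_of_tendsto hn hp h)
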